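/- **Theorem (converse for guessing).** Let $\log=\log_2$. A *finite-state (hidden Markov) source* with $s$ states over an alphabet of size $\alpha$ consists of a finite alphabet $\mathcal X$ with $|\mathcal X|=\alpha$, a finite state set $\mathcal Z$ with $|\mathcal Z|=s$, a fixed initial state $z_1\in\mathcal Z$ and conditional probabilities $P(x,z'|z)\ge 0$ with $\sum_{x,z'}P(x,z'|z)=1$ for each $z\in\mathcal Z$; for every $n$ it defines the distribution $$P(\boldsymbol x)=\sum_{(z_2,\dots,z_{n+1})\in\mathcal Z^n}\ \prod_{i=1}^nP(x_i,z_{i+1}|z_i),\qquad \boldsymbol x=(x_1,\dots,x_n)\in\mathcal X^n .$$ A *guessing function* is a bijection $G:\mathcal X^n\to\{1,\dots,\alpha^n\}$. Let $c(\boldsymbol x)$ be the number of phrases in the incremental (LZ78) parsing of $\boldsymbol x$, in which the word is read from left to right and each new phrase is the shortest string that has not been obtained before as a phrase; a nonempty incomplete remainder at the end of the word is counted as a phrase. We use $0\log 0=0$. There are real numbers $\Delta_n=\Delta_n(s,\alpha)$, depending only on $s$, $\alpha$ and $n$, with $\Delta_n\to0$ as $n\to\infty$ for all fixed $s$ and $\alpha$,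 such that for every finite-state source with $s$ states over an alphabet of size $\alpha$, every $n$, every guessing function $G:\mathcal X^n\to\{1,\dots,\alpha^n\}$ and every real $\rho>0$, $$\mathbf E\{G^\rho(\boldsymbol X)\}\ \ge\ 2^{-\rho n\Delta_n}\,\mathbf E\big[2^{\rho\,c(\boldsymbol X)\log c(\boldsymbol X)}\big],$$ where $\boldsymbol X=(X_1,\dots,X_n)$ is drawn from the source. In particular, for each fixed $\rho>0$ the inequality holds with the factor $2^{-n\Delta'_n}$, where $\Delta_n'=\rho\Delta_n\to0$. -/

import Mathlib

/-- A finite-state (hidden Markov) source with alphabet `X` and state set `Z`: a fixed initial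
state and the conditional probabilities `prob z x z'` of emitting the letter `x` and moving to
the state `z'`, given the current state `z`. -/
structure FiniteStateSource (X Z : Type*) [Fintype X] [Fintype Z] where
  init : Z
  prob : Z → X → Z → ℝ
  prob_nonneg : ∀ z x z', 0 ≤ prob z x z'
  prob_sum : ∀ z, ∑ x, ∑ z', prob z x z' = 1

namespace FiniteStateSource

variable {X Z : Type*} [Fintype X] [Fintype Z]

/-- The full state sequence `z₁, z₂, …, zₙ₊₁`, where `z₁` is the initial state and
`z = (z₂, …, zₙ₊₁)`. -/
def path (P : FiniteStateSource X Z) {n : ℕ} (z : Fin n → Z) : Fin (n + 1) → Z :=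
  Fin.cons P.init z

/-- The probability of the word `x = (x₁, …, xₙ)`: the sum over all state sequences starting at
the initial state of `∏ i, P(xᵢ, zᵢ₊₁ | zᵢ)`. -/
noncomputable def wordProb (P : FiniteStateSource X Z) {n : ℕ} (x : Fin n → X) : ℝ :=
  ∑ z : Fin n → Z, ∏ i : Fin n, P.prob (P.path z i.castSucc) (x i) (P.path z i.succ)

/-- The expectation of `f(X₁, …, Xₙ)` when `(X₁, …, Xₙ)` is drawn from the source. -/
noncomputable def expect (P : FiniteStateSource X Z) {n : ℕ} (f : (Fin n → X) → ℝ) : ℝ :=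
  ∑ x : Fin n → X, P.wordProb x * f x

end FiniteStateSource

/-- A (deterministic) guessing function on words of length `n`: a bijection from `Xⁿ` onto
`{1, …, |X|ⁿ}`; `G x` is the position of `x` in the guessing list. -/
def IsGuessingFunction {X : Type*} [Fintype X] {n : ℕ} (G : (Fin n → X) → ℕ) : Prop :=
  Set.BijOn G Set.univ (Set.Icc 1 (Fintype.card X ^ n))

/-- One run of incremental parsing. `phrases` are the phrases found so far, `cur` is the part of
the current phrase read so far, and the last argument is what remains to be read. The current
phrase is closed as soon as it differs from all earlier phrases. When the input ends inside a
phrase, the nonempty remainder is kept as a last, incomplete, phrase. -/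
def lzParseAux {X : Type*} [DecidableEq X] :
    List (List X) → List X → List X → List (List X)
  | phrases, cur, [] => if cur = [] then phrases else phrases ++ [cur]
  | phrases, cur, a :: rest =>
    if cur ++ [a] ∈ phrases then lzParseAux phrases (cur ++ [a]) rest
    else lzParseAux (phrases ++ [cur ++ [a]]) [] rest

/-- The list of phrases of the Lempel-Ziv (1978) incremental parsing of a word. -/
def lzParse {X : Type*} [DecidableEq X] (w : List X) : List (List X) :=
  lzParseAux [] [] w

/-- The number `c(x)` of phrases in the incremental parsing of `x`. -/
def lzCount {X : Type*} [DecidableEq X] {n : ℕ} (x : Fin n → X) : ℕ :=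
  (lzParse (List.ofFn x)).length

/-!
Split the words of length `n` according to the lengths `l` of their phrases, and the probability of
a word according to the states `z` at the phrase boundaries. Permuting the phrases that have the
same length and the same states at both ends does not change the probability. As there are few
possible labels, there are at least `c ^ c` such permutations, up to a subexponential factor `D`.

For large `ρ`, average over these permutations: the rearranged words are distinct, so that
`∑ 1 / G` over them is at most the harmonic sum `H`, and the power mean inequality bounds the
average of `G ^ ρ` from below by about `c ^ (ρ * c)`. This costs `D * (D * H) ^ ρ`, where the first
factor `D`, from the choice of `l`, is not raised to the power `ρ`. For small `ρ` that factor is too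
expensive. Then Ziv's inequality `P(x) * c ^ c ≤ D`, which has the same source, is combined with the
power mean inequality for the tilted weights `P(x) * c ^ (ρ * c)`; the loss is
`(D * H * (D * α ^ n) ^ ρ) ^ ρ`. Writing `D * H = 2 ^ (n * v)` and switching at `ρ = √v`, both
losses are `2 ^ (ρ * n * o(1))`, uniformly in `ρ`.
-/

section PowerMeans

variable {ι : Type*} (t : Finset ι) {ρ : ℝ}

theorem rpow_sum_one_add_le {w g : ι → ℝ} (hw : ∀ i, 0 ≤ w i) (hg : ∀ i, 0 < g i) (hρ : 0 ≤ ρ) :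
    (∑ i ∈ t, w i) ^ (1 + ρ) ≤ (∑ i ∈ t, w i / g i) ^ ρ * ∑ i ∈ t, w i * g i ^ ρ := by
  have hA : 0 ≤ ∑ i ∈ t, w i / g i := Finset.sum_nonneg fun i _ => div_nonneg (hw i) (hg i).le
  have hB : 0 ≤ ∑ i ∈ t, w i * g i ^ ρ :=
    Finset.sum_nonneg fun i _ => mul_nonneg (hw i) (Real.rpow_nonneg (hg i).le _)
  have holder := Real.inner_le_weight_mul_Lp_of_nonneg t (p := 1 + ρ) (by linarith)
    (fun i => w i / g i) g (fun i => div_nonneg (hw i) (hg i).le) (fun i => (hg i).le)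
  have hterm (i : ι) : w i / g i * g i ^ (1 + ρ) = w i * g i ^ ρ := by
    rw [Real.rpow_one_add' (hg i).le (by positivity), ← mul_assoc, div_mul_cancel₀ _ (hg i).ne']
  simp only [hterm, div_mul_cancel₀ _ (hg _).ne'] at holder
  calc (∑ i ∈ t, w i) ^ (1 + ρ)
      ≤ ((∑ i ∈ t, w i / g i) ^ (1 - (1 + ρ)⁻¹) *
          (∑ i ∈ t, w i * g i ^ ρ) ^ (1 + ρ)⁻¹) ^ (1 + ρ) :=
        Real.rpow_le_rpow (Finset.sum_nonneg fun i _ => hw i) holder (by positivity)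
    _ = (∑ i ∈ t, w i / g i) ^ ρ * ∑ i ∈ t, w i * g i ^ ρ := by
        rw [Real.mul_rpow (by positivity) (by positivity), ← Real.rpow_mul hA,
          Real.rpow_inv_rpow hB (by positivity)]
        congr 2
        field_simp
        ring

theorem sum_mul_rpow_le_of_mul_le {p M g : ι → ℝ} {K B : ℝ} (hp : ∀ i, 0 ≤ p i)
    (hp_sum : ∑ i ∈ t, p i = 1) (hM : ∀ i, 1 ≤ M i) (hMB : ∀ i ∈ t, M i ≤ B)
    (hpM : ∀ i ∈ t, p i * M i ≤ K) (hg : ∀ i, 0 < g i) (hρ : 0 ≤ ρ) :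
    ∑ i ∈ t, p i * M i ^ ρ ≤
      (K * B ^ ρ * ∑ i ∈ t, 1 / g i) ^ ρ * ∑ i ∈ t, p i * g i ^ ρ := by
  have hM0 (i : ι) : 0 < M i := one_pos.trans_le (hM i)
  have hW : 1 ≤ ∑ i ∈ t, p i * M i ^ ρ := by
    rw [← hp_sum]
    exact Finset.sum_le_sum fun i _ =>
      le_mul_of_one_le_right (hp i) (Real.one_le_rpow (hM i) hρ)
  have tilted := rpow_sum_one_add_le t (w := fun i => p i * M i ^ ρ) (g := fun i => g i / M i)
    (fun i => mul_nonneg (hp i) (Real.rpow_nonneg (hM0 i).le _))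
    (fun i => div_pos (hg i) (hM0 i)) hρ
  have hcancel (i : ι) : p i * M i ^ ρ * (g i / M i) ^ ρ = p i * g i ^ ρ := by
    rw [mul_assoc, ← Real.mul_rpow (hM0 i).le (div_pos (hg i) (hM0 i)).le,
      mul_div_cancel₀ _ (hM0 i).ne']
  have hinv : ∑ i ∈ t, p i * M i ^ ρ / (g i / M i) ≤ K * B ^ ρ * ∑ i ∈ t, 1 / g i := by
    rw [Finset.mul_sum]
    refine Finset.sum_le_sum fun i hi => ?_
    have hK : 0 ≤ K := (mul_nonneg (hp i) (hM0 i).le).trans (hpM i hi)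
    calc p i * M i ^ ρ / (g i / M i) = p i * M i * M i ^ ρ * (1 / g i) := by
          rw [div_div_eq_mul_div]; ring
      _ ≤ K * B ^ ρ * (1 / g i) := by
          have := hpM i hi
          have := hMB i hi
          have := hM0 i
          have := hg i
          gcongr
  simp only [hcancel] at tilted
  calc ∑ i ∈ t, p i * M i ^ ρ ≤ (∑ i ∈ t, p i * M i ^ ρ) ^ (1 + ρ) :=
        Real.self_le_rpow_of_one_le hW (by linarith)
    _ ≤ _ := tilted
    _ ≤ _ := by
        gcongr
        · exact Finset.sum_nonneg fun i _ => mul_nonneg (hp i) (Real.rpow_nonneg (hg i).le _)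
        · exact Finset.sum_nonneg fun i _ =>
            div_nonneg (mul_nonneg (hp i) (Real.rpow_nonneg (hM0 i).le _))
              (div_pos (hg i) (hM0 i)).le

end PowerMeans

section LabelPerms

variable {ι Λ β : Type*} [Fintype ι] [DecidableEq ι] [DecidableEq Λ]

/-- The permutations of the index set of a family `ℓ` of labels that preserve every label: the
symmetries by which the phrases of a word are rearranged. -/
def labelPerms (ℓ : ι → Λ) : Finset (Equiv.Perm ι) :=
  Finset.univ.filter fun π => ℓ ∘ π = ℓ

theorem mem_labelPerms {ℓ : ι → Λ} {π : Equiv.Perm ι} : π ∈ labelPerms ℓ ↔ ℓ ∘ π = ℓ := by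
  simp [labelPerms]

theorem card_labelPerms_pos (ℓ : ι → Λ) : 0 < (labelPerms ℓ).card :=
  Finset.card_pos.2 ⟨1, mem_labelPerms.2 rfl⟩

theorem card_filter_comp_perm_eq_le (ℓ m : ι → Λ) :
    (Finset.univ.filter fun π : Equiv.Perm ι => ℓ ∘ π = m).card ≤ (labelPerms ℓ).card := by
  rcases (Finset.univ.filter fun π : Equiv.Perm ι => ℓ ∘ π = m).eq_empty_or_nonempty with
    h | ⟨σ, hσ⟩
  · simp [h]
  refine Finset.card_le_card_of_injOn (· * σ⁻¹) (fun π hπ => ?_) (mul_left_injective _).injOn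
  rw [Finset.mem_filter_univ] at hσ
  rw [Finset.mem_coe, Finset.mem_filter_univ] at hπ
  rw [Finset.mem_coe, mem_labelPerms, Equiv.Perm.coe_mul, ← Function.comp_assoc, hπ, ← hσ]
  ext i
  simp

theorem factorial_mul_prod_le_card_labelPerms (ℓ : ι → Λ) {t : Finset Λ} (hℓ : ∀ i, ℓ i ∈ t)
    {q : Λ → ℝ} (hq : ∀ a, 0 ≤ q a) (hq_sum : ∑ a ∈ t, q a ≤ 1) :
    ((Fintype.card ι).factorial : ℝ) * ∏ i, q (ℓ i) ≤ (labelPerms ℓ).card := by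
  have hprod (m : ι → Λ) : 0 ≤ ∏ i, q (m i) := Finset.prod_nonneg fun i _ => hq _
  have hmaps : Finset.univ.image (fun π : Equiv.Perm ι => ℓ ∘ π) ⊆ Fintype.piFinset fun _ => t := by
    simp [Finset.subset_iff, hℓ]
  calc ((Fintype.card ι).factorial : ℝ) * ∏ i, q (ℓ i)
      = ∑ π : Equiv.Perm ι, ∏ i, q ((ℓ ∘ π) i) := by
        simp [Equiv.prod_comp _ fun i => q (ℓ i), Fintype.card_perm]
    _ = ∑ m ∈ Finset.univ.image (fun π : Equiv.Perm ι => ℓ ∘ π),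
          (Finset.univ.filter fun π : Equiv.Perm ι => ℓ ∘ π = m).card • ∏ i, q (m i) :=
        Finset.sum_comp (fun m : ι → Λ => ∏ i, q (m i)) _
    _ ≤ ∑ m ∈ Finset.univ.image (fun π : Equiv.Perm ι => ℓ ∘ π),
          (labelPerms ℓ).card • ∏ i, q (m i) :=
        Finset.sum_le_sum fun m _ =>
          nsmul_le_nsmul_left (hprod m) (card_filter_comp_perm_eq_le ℓ m)
    _ ≤ ∑ m ∈ Fintype.piFinset fun _ : ι => t, (labelPerms ℓ).card • ∏ i, q (m i) :=
        Finset.sum_le_sum_of_subset_of_nonneg hmaps fun m _ _ => nsmul_nonneg (hprod m) _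
    _ = (labelPerms ℓ).card * (∑ a ∈ t, q a) ^ Fintype.card ι := by
        rw [← Finset.smul_sum, nsmul_eq_mul, ← Finset.prod_univ_sum (fun _ => t) fun _ => q]
        simp
    _ ≤ (labelPerms ℓ).card :=
        mul_le_of_le_one_right (Nat.cast_nonneg _)
          (pow_le_one₀ (Finset.sum_nonneg fun a _ => hq a) hq_sum)

theorem pow_self_mul_prod_le_card_labelPerms (ℓ : ι → Λ) {t : Finset Λ} (hℓ : ∀ i, ℓ i ∈ t)
    {q : Λ → ℝ} (hq : ∀ a, 0 ≤ q a) (hq_sum : ∑ a ∈ t, q a ≤ 1) :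
    (Fintype.card ι : ℝ) ^ Fintype.card ι * ∏ i, q (ℓ i) ≤
      Real.exp 1 ^ Fintype.card ι * (labelPerms ℓ).card := by
  have hstirling := Real.pow_div_factorial_le_exp (Fintype.card ι : ℝ) (Nat.cast_nonneg _)
    (Fintype.card ι)
  rw [div_le_iff₀ (by positivity), ← Real.exp_one_pow] at hstirling
  calc (Fintype.card ι : ℝ) ^ Fintype.card ι * ∏ i, q (ℓ i)
      ≤ Real.exp 1 ^ Fintype.card ι * (Fintype.card ι).factorial * ∏ i, q (ℓ i) :=
        mul_le_mul_of_nonneg_right hstirling (Finset.prod_nonneg fun i _ => hq _)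
    _ ≤ _ := by
        rw [mul_assoc]
        gcongr
        exact factorial_mul_prod_le_card_labelPerms ℓ hℓ hq hq_sum

theorem injOn_comp_labelPerms {ℓ : ι → Λ} {y : ι → β}
    (hy : Function.Injective fun i => (ℓ i, y i)) :
    Set.InjOn (fun π : Equiv.Perm ι => y ∘ π) (labelPerms ℓ) := by
  intro π hπ σ hσ h
  have hℓ : ℓ ∘ π = ℓ ∘ σ := (mem_labelPerms.1 hπ).trans (mem_labelPerms.1 hσ).symm
  exact Equiv.ext fun i => hy (Prod.ext (congrFun hℓ i) (congrFun h i))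

variable {ℓ : ι → Λ} {B : Finset (ι → β)}

theorem sum_comp_labelPerms_le {y : ι → β} (hy : Function.Injective fun i => (ℓ i, y i))
    (hB : ∀ π ∈ labelPerms ℓ, y ∘ π ∈ B) {f : (ι → β) → ℝ} (hf : ∀ x, 0 ≤ f x) :
    ∑ π ∈ labelPerms ℓ, f (y ∘ π) ≤ ∑ x ∈ B, f x := by
  classical
  rw [← Finset.sum_image (f := f) (injOn_comp_labelPerms hy)]
  exact Finset.sum_le_sum_of_subset_of_nonneg (Finset.image_subset_iff.2 hB) fun x _ _ => hf x

variable {g : (ι → β) → ℝ} {M D H ρ : ℝ}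

theorem card_labelPerms_mul_rpow_le {y : ι → β} (hy : Function.Injective fun i => (ℓ i, y i))
    (hB : ∀ π ∈ labelPerms ℓ, y ∘ π ∈ B) (hg : ∀ x, 0 < g x) (hH : ∑ x ∈ B, 1 / g x ≤ H)
    (hM : 0 ≤ M) (hD : 0 ≤ D) (hMD : M ≤ D * (labelPerms ℓ).card) (hρ : 0 ≤ ρ) :
    (labelPerms ℓ).card * M ^ ρ ≤ (D * H) ^ ρ * ∑ π ∈ labelPerms ℓ, g (y ∘ π) ^ ρ := by
  have hcard : (0 : ℝ) < (labelPerms ℓ).card := mod_cast card_labelPerms_pos ℓ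
  have hinv : 0 ≤ ∑ π ∈ labelPerms ℓ, 1 / g (y ∘ π) :=
    Finset.sum_nonneg fun π _ => (one_div_pos.2 (hg _)).le
  have hinvH := (sum_comp_labelPerms_le hy hB fun x => (one_div_pos.2 (hg x)).le).trans hH
  have hH0 : 0 ≤ H := hinv.trans hinvH
  have hmean := rpow_sum_one_add_le (labelPerms ℓ) (w := fun _ => 1) (fun _ => zero_le_one)
    (fun π => hg (y ∘ π)) hρ
  simp only [Finset.sum_const, nsmul_eq_mul, mul_one, one_mul] at hmean
  calc ((labelPerms ℓ).card : ℝ) * M ^ ρ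
      ≤ (labelPerms ℓ).card * (D * (labelPerms ℓ).card) ^ ρ := by gcongr
    _ = D ^ ρ * (labelPerms ℓ).card ^ (1 + ρ) := by
        rw [Real.mul_rpow hD hcard.le, Real.rpow_add hcard, Real.rpow_one]
        ring
    _ ≤ D ^ ρ * (H ^ ρ * ∑ π ∈ labelPerms ℓ, g (y ∘ π) ^ ρ) := by
        gcongr
        refine hmean.trans ?_
        gcongr
        exact Finset.sum_nonneg fun π _ => Real.rpow_nonneg (hg _).le _
    _ = _ := by rw [Real.mul_rpow hD hH0, mul_assoc]

theorem sum_mul_rpow_le_of_labelPerms {A : Finset (ι → β)} {p : (ι → β) → ℝ} (hAB : A ⊆ B)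
    (hA : ∀ y ∈ A, Function.Injective fun i => (ℓ i, y i))
    (hB : ∀ y ∈ B, ∀ π ∈ labelPerms ℓ, y ∘ π ∈ B)
    (hp : ∀ y, 0 ≤ p y) (hp_comp : ∀ y, ∀ π ∈ labelPerms ℓ, p (y ∘ π) = p y)
    (hg : ∀ x, 0 < g x) (hH : ∑ x ∈ B, 1 / g x ≤ H)
    (hM : 0 ≤ M) (hD : 0 ≤ D) (hMD : M ≤ D * (labelPerms ℓ).card) (hρ : 0 ≤ ρ) :
    ∑ y ∈ A, p y * M ^ ρ ≤ (D * H) ^ ρ * ∑ y ∈ B, p y * g y ^ ρ := by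
  classical
  have hterm (y : ι → β) : 0 ≤ p y * g y ^ ρ :=
    mul_nonneg (hp y) (Real.rpow_nonneg (hg y).le _)
  have hH0 : 0 ≤ H := (Finset.sum_nonneg fun x _ => (one_div_pos.2 (hg x)).le).trans hH
  have hrearranged : ∀ π ∈ labelPerms ℓ,
      ∑ y ∈ A, p (y ∘ π) * g (y ∘ π) ^ ρ ≤ ∑ y ∈ B, p y * g y ^ ρ := by
    intro π hπ
    rw [← Finset.sum_image (f := fun y => p y * g y ^ ρ) (g := fun y : ι → β => y ∘ π)
      π.surjective.injective_comp_right.injOn]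
    exact Finset.sum_le_sum_of_subset_of_nonneg
      (Finset.image_subset_iff.2 fun y hy => hB y (hAB hy) π hπ) fun y _ _ => hterm y
  have hcard : (0 : ℝ) < (labelPerms ℓ).card := mod_cast card_labelPerms_pos ℓ
  refine le_of_mul_le_mul_left ?_ hcard
  calc ((labelPerms ℓ).card : ℝ) * ∑ y ∈ A, p y * M ^ ρ
      = ∑ y ∈ A, p y * ((labelPerms ℓ).card * M ^ ρ) := by
        rw [Finset.mul_sum]
        exact Finset.sum_congr rfl fun y _ => mul_left_comm _ _ _
    _ ≤ ∑ y ∈ A, p y * ((D * H) ^ ρ * ∑ π ∈ labelPerms ℓ, g (y ∘ π) ^ ρ) :=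
        Finset.sum_le_sum fun y hy => mul_le_mul_of_nonneg_left
          (card_labelPerms_mul_rpow_le (hA y hy) (hB y (hAB hy)) hg hH hM hD hMD hρ) (hp y)
    _ = (D * H) ^ ρ * ∑ π ∈ labelPerms ℓ, ∑ y ∈ A, p (y ∘ π) * g (y ∘ π) ^ ρ := by
        rw [Finset.sum_comm, Finset.mul_sum]
        refine Finset.sum_congr rfl fun y _ => ?_
        rw [mul_left_comm, Finset.mul_sum]
        exact congrArg _ (Finset.sum_congr rfl fun π hπ => by rw [hp_comp y π hπ])
    _ ≤ (D * H) ^ ρ * ∑ _π ∈ labelPerms ℓ, ∑ y ∈ B, p y * g y ^ ρ :=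
        mul_le_mul_of_nonneg_left (Finset.sum_le_sum hrearranged) (by positivity)
    _ = _ := by rw [Finset.sum_const, nsmul_eq_mul, mul_left_comm]

end LabelPerms

section Lengths

theorem sum_pow_length_composition_le {η : ℝ} (hη : 0 ≤ η) (n : ℕ) :
    ∑ c : Composition n, η ^ c.length ≤ (1 + η) ^ n := by
  let cuts (c : Composition n) : Finset (Fin n) := Finset.univ.filter fun i => i.succ ∈ c.boundaries
  have hboundaries (c : Composition n) :
      c.boundaries = insert 0 ((cuts c).map (Fin.succEmb n)) := by
    ext i
    cases i using Fin.cases with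
    | zero => simpa using c.toCompositionAsSet.zero_mem
    | succ i => simp [cuts]
  have hcard (c : Composition n) : (cuts c).card = c.length := by
    have h := c.card_boundaries_eq_succ_length
    rw [hboundaries c, Finset.card_insert_of_notMem (by simp), Finset.card_map] at h
    exact Nat.succ_injective h
  have hinj : Function.Injective cuts := fun c d h => (compositionEquiv n).injective <|
    CompositionAsSet.ext ((hboundaries c).trans (h ▸ (hboundaries d).symm))
  calc ∑ c : Composition n, η ^ c.length
      = ∑ s ∈ Finset.univ.image cuts, η ^ s.card := by
        rw [Finset.sum_image hinj.injOn]
        simp only [hcard]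
    _ ≤ ∑ s : Finset (Fin n), η ^ s.card * 1 ^ (n - s.card) := by
        simp only [one_pow, mul_one]
        exact Finset.sum_le_sum_of_subset_of_nonneg (Finset.subset_univ _)
          fun s _ _ => pow_nonneg hη _
    _ = (1 + η) ^ n := by rw [Fin.sum_pow_mul_eq_add_pow, add_comm]

theorem card_le_of_sum_of_length_le {n : ℕ} {η κ : ℝ} (hη : 0 < η) {T : Finset (List ℕ)}
    (hpos : ∀ L ∈ T, ∀ k ∈ L, 0 < k) (hsum : ∀ L ∈ T, L.sum = n)
    (hlength : ∀ L ∈ T, (L.length : ℝ) ≤ κ) :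
    (T.card : ℝ) ≤ ((1 + η) / η) ^ κ * (1 + η) ^ n := by
  have hbase : 1 ≤ (1 + η) / η := by rw [le_div_iff₀ hη]; linarith
  have hterm : ∀ L ∈ T, 1 ≤ ((1 + η) / η) ^ κ * η ^ L.length := by
    intro L hL
    calc (1 : ℝ) ≤ (1 + η) ^ L.length := one_le_pow₀ (by linarith)
      _ = ((1 + η) / η) ^ (L.length : ℝ) * η ^ L.length := by
        rw [Real.rpow_natCast, ← mul_pow, div_mul_cancel₀ _ hη.ne']
      _ ≤ _ := by
        gcongr
        exact hlength L hL
  have hblocks : T ⊆ Finset.univ.image (Composition.blocks : Composition n → List ℕ) :=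
    fun L hL => Finset.mem_image.2 ⟨⟨L, hpos L hL _, hsum L hL⟩, Finset.mem_univ _, rfl⟩
  calc (T.card : ℝ) = ∑ _ ∈ T, (1 : ℝ) := by simp
    _ ≤ ∑ L ∈ T, ((1 + η) / η) ^ κ * η ^ L.length := Finset.sum_le_sum hterm
    _ ≤ ∑ L ∈ Finset.univ.image (Composition.blocks : Composition n → List ℕ),
          ((1 + η) / η) ^ κ * η ^ L.length :=
        Finset.sum_le_sum_of_subset_of_nonneg hblocks fun _ _ _ => by positivity
    _ = ((1 + η) / η) ^ κ * ∑ c : Composition n, η ^ c.length := by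
        rw [Finset.sum_image fun c _ d _ h => Composition.ext h, Finset.mul_sum]
    _ ≤ _ := by
        gcongr
        exact sum_pow_length_composition_le hη.le n

/-- The geometric distribution `k ↦ η / (1 + η) ^ (k + 1)`, used as a prior on phrase lengths. -/
noncomputable def lengthWeight (η : ℝ) (k : ℕ) : ℝ := η / (1 + η) ^ (k + 1)

theorem lengthWeight_nonneg {η : ℝ} (hη : 0 ≤ η) (k : ℕ) : 0 ≤ lengthWeight η k := by
  unfold lengthWeight
  positivity

theorem sum_range_lengthWeight {η : ℝ} (hη : 0 ≤ η) (m : ℕ) :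
    ∑ k ∈ Finset.range m, lengthWeight η k = 1 - ((1 + η) ^ m)⁻¹ := by
  induction m with
  | zero => simp
  | succ m ih =>
    rw [Finset.sum_range_succ, ih, lengthWeight]
    field_simp
    ring

theorem prod_lengthWeight {ι : Type*} [Fintype ι] (η : ℝ) (l : ι → ℕ) :
    ∏ i, lengthWeight η (l i) = (η / (1 + η)) ^ Fintype.card ι / (1 + η) ^ ∑ i, l i := by
  simp only [lengthWeight, pow_succ', ← div_div, Finset.prod_div_distrib, Finset.prod_const,
    Finset.prod_pow_eq_pow_sum, Finset.card_univ, div_pow]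

end Lengths

section Words

variable {X : Type*} [Fintype X]

variable (X) in
/-- The words of length `n`, as lists, so that phrases can be concatenated. -/
def words (n : ℕ) : Finset (List X) :=
  Finset.univ.map ⟨fun x : Fin n → X => List.ofFn x, List.ofFn_injective⟩

theorem mem_words {n : ℕ} {w : List X} : w ∈ words X n ↔ w.length = n := by
  simp only [words, Finset.mem_map, Finset.mem_univ, true_and, Function.Embedding.coeFn_mk]
  constructor
  · rintro ⟨x, rfl⟩
    exact List.length_ofFn
  · rintro rfl
    exact ⟨w.get, List.ofFn_get w⟩

theorem card_words (n : ℕ) : (words X n).card = Fintype.card X ^ n := by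
  simp [words]

theorem sum_words (n : ℕ) (f : List X → ℝ) :
    ∑ w ∈ words X n, f w = ∑ x : Fin n → X, f (List.ofFn x) :=
  Finset.sum_map _ _ _

theorem sum_words_succ (n : ℕ) (f : List X → ℝ) :
    ∑ w ∈ words X (n + 1), f w = ∑ a, ∑ w ∈ words X n, f (a :: w) := by
  simp only [sum_words]
  rw [← (Fin.consEquiv fun _ : Fin (n + 1) => X).sum_comp, Fintype.sum_prod_type]
  simp [Fin.consEquiv]

theorem card_le_of_length_le {k : ℕ} {A : Finset (List X)} (hA : ∀ w ∈ A, w.length ≤ k) :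
    A.card ≤ (Fintype.card X + 1) ^ k := by
  classical
  have hcover : A ⊆ (Finset.range (k + 1)).biUnion (words X) := fun w hw =>
    Finset.mem_biUnion.2
      ⟨w.length, Finset.mem_range.2 (Nat.lt_succ_of_le (hA w hw)), mem_words.2 rfl⟩
  calc A.card ≤ ∑ i ∈ Finset.range (k + 1), Fintype.card X ^ i := by
        simpa only [card_words] using (Finset.card_le_card hcover).trans Finset.card_biUnion_le
    _ ≤ ∑ i ∈ Finset.range (k + 1), Fintype.card X ^ i * 1 ^ (k - i) * k.choose i := by
        refine Finset.sum_le_sum fun i hi => ?_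
        rw [one_pow, mul_one]
        exact Nat.le_mul_of_pos_right _ (Nat.choose_pos (Finset.mem_range_succ_iff.1 hi))
    _ = (Fintype.card X + 1) ^ k := (add_pow _ _ _).symm

theorem card_mul_le_add_sum_length (A : Finset (List X)) (k : ℕ) :
    A.card * (k + 1) ≤ (Fintype.card X + 1) ^ k * (k + 1) + ∑ w ∈ A, w.length := by
  have hshort : (A.filter fun w => w.length ≤ k).card ≤ (Fintype.card X + 1) ^ k :=
    card_le_of_length_le fun w hw => (Finset.mem_filter.1 hw).2
  have hlong : (A.filter fun w => ¬w.length ≤ k).card * (k + 1) ≤ ∑ w ∈ A, w.length :=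
    (Finset.card_nsmul_le_sum _ List.length _ fun w hw =>
      not_le.1 (Finset.mem_filter.1 hw).2).trans
      (Finset.sum_le_sum_of_subset (Finset.filter_subset _ A))
  calc A.card * (k + 1)
      = (A.filter fun w => w.length ≤ k).card * (k + 1) +
          (A.filter fun w => ¬w.length ≤ k).card * (k + 1) := by
        rw [← add_mul, Finset.card_filter_add_card_filter_not]
    _ ≤ _ := add_le_add (Nat.mul_le_mul_right _ hshort) hlong

variable {c : ℕ}

/-- The sequences of words with prescribed lengths `l`, i.e. the ways of filling blocks of these
lengths with letters. -/
def blockWords (X : Type*) [Fintype X] (l : Fin c → ℕ) : Finset (Fin c → List X) :=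
  Fintype.piFinset fun j => words X (l j)

theorem mem_blockWords {l : Fin c → ℕ} {y : Fin c → List X} :
    y ∈ blockWords X l ↔ ∀ j, (y j).length = l j := by
  simp only [blockWords, Fintype.mem_piFinset, mem_words]

theorem sum_blockWords_flatten (l : Fin c → ℕ) (f : List X → ℝ) :
    ∑ y ∈ blockWords X l, f (List.ofFn y).flatten = ∑ w ∈ words X (∑ j, l j), f w := by
  classical
  have hinj : Set.InjOn (fun y : Fin c → List X => (List.ofFn y).flatten) (blockWords X l) := by
    intro y hy y' hy' h
    refine List.ofFn_injective (List.eq_iff_flatten_eq.2 ⟨h, ?_⟩)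
    rw [List.map_ofFn, List.map_ofFn]
    exact congrArg List.ofFn (funext fun j =>
      (mem_blockWords.1 hy j).trans (mem_blockWords.1 hy' j).symm)
  have himage : (blockWords X l).image (fun y => (List.ofFn y).flatten) =
      words X (∑ j, l j) := by
    refine Finset.eq_of_subset_of_card_le (Finset.image_subset_iff.2 fun y hy => ?_) ?_
    · rw [mem_words, List.length_flatten, List.map_ofFn, List.sum_ofFn]
      exact Finset.sum_congr rfl fun j _ => mem_blockWords.1 hy j
    · rw [Finset.card_image_of_injOn hinj, card_words, blockWords, Fintype.card_piFinset,
        ← Finset.prod_pow_eq_pow_sum]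
      simp only [card_words, le_refl]
  rw [← himage, Finset.sum_image hinj]

end Words

section Parsing

variable {X : Type*} [DecidableEq X]

theorem flatten_lzParseAux (phrases : List (List X)) (cur w : List X) :
    (lzParseAux phrases cur w).flatten = phrases.flatten ++ cur ++ w := by
  fun_induction lzParseAux phrases cur w <;> simp_all

theorem nodup_dropLast_lzParseAux {phrases : List (List X)} (cur w : List X)
    (h : phrases.Nodup) : (lzParseAux phrases cur w).dropLast.Nodup := by
  fun_induction lzParseAux phrases cur w with
  | case1 => exact h.sublist (List.dropLast_sublist _)
  | case2 => simpa using h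
  | case3 _ _ _ _ _ ih => exact ih h
  | case4 _ _ _ _ hnew ih =>
    exact ih (h.append (List.nodup_singleton _) (List.disjoint_singleton.2 hnew))

theorem nil_notMem_lzParseAux {phrases : List (List X)} (cur w : List X)
    (h : [] ∉ phrases) : [] ∉ lzParseAux phrases cur w := by
  fun_induction lzParseAux phrases cur w <;> simp_all

theorem flatten_lzParse (w : List X) : (lzParse w).flatten = w :=
  flatten_lzParseAux [] [] w

theorem nodup_dropLast_lzParse (w : List X) : (lzParse w).dropLast.Nodup :=
  nodup_dropLast_lzParseAux [] w List.nodup_nil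

theorem length_pos_of_mem_lzParse {w p : List X} (hp : p ∈ lzParse w) : 0 < p.length :=
  List.length_pos_iff.2 fun h =>
    nil_notMem_lzParseAux (phrases := []) [] w List.not_mem_nil (by rwa [h] at hp)

theorem sum_map_length_lzParse (w : List X) : ((lzParse w).map List.length).sum = w.length := by
  rw [← List.length_flatten, flatten_lzParse]

theorem sum_length_get_lzParse (w : List X) : ∑ j, ((lzParse w).get j).length = w.length := by
  rw [← List.sum_ofFn, ← Function.comp_def List.length, ← List.map_ofFn, List.ofFn_get,
    sum_map_length_lzParse]

theorem nodup_dropLast_ofFn_get_lzParse (w : List X) :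
    (List.ofFn (lzParse w).get).dropLast.Nodup := by
  rw [List.ofFn_get]
  exact nodup_dropLast_lzParse w

theorem lzParse_flatten_ofFn {c : ℕ} {y : Fin c → List X}
    (h : (lzParse (List.ofFn y).flatten).map List.length = (List.ofFn y).map List.length) :
    lzParse (List.ofFn y).flatten = List.ofFn y :=
  List.eq_iff_flatten_eq.2 ⟨flatten_lzParse _, h⟩

theorem length_lzParse_mul_le [Fintype X] (w : List X) (k : ℕ) :
    (lzParse w).length * (k + 1) ≤ (1 + (Fintype.card X + 1) ^ k) * (k + 1) + w.length := by
  have hnodup := nodup_dropLast_lzParse w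
  have hcard : (lzParse w).length ≤ (lzParse w).dropLast.toFinset.card + 1 := by
    rw [List.toFinset_card_of_nodup hnodup, List.length_dropLast]
    omega
  have hsum : ∑ p ∈ (lzParse w).dropLast.toFinset, p.length ≤ w.length := by
    rw [List.sum_toFinset _ hnodup, ← sum_map_length_lzParse w]
    exact ((List.dropLast_sublist _).map _).sum_le_sum fun _ _ => Nat.zero_le _
  calc (lzParse w).length * (k + 1)
      ≤ (k + 1) + (lzParse w).dropLast.toFinset.card * (k + 1) := by
        rw [← one_add_mul, add_comm 1]
        exact Nat.mul_le_mul_right _ hcard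
    _ ≤ (k + 1) + ((Fintype.card X + 1) ^ k * (k + 1) + w.length) := by
        gcongr
        exact (card_mul_le_add_sum_length _ k).trans (by gcongr)
    _ = _ := by ring

end Parsing

namespace FiniteStateSource

variable {X Z : Type*} [Fintype X] [Fintype Z] (P : FiniteStateSource X Z)

section Labels

variable {c : ℕ} (z : Fin c → Z) (l : Fin c → ℕ)

/-- What a rearrangement of consecutive blocks of lengths `l` has to preserve when the states at the
block boundaries are `z`: the states at the two ends of a block, so that the probability does not
change, its length, so that the blocks can be recovered from the word, and whether it is the last
one, as the last phrase of a parsing may repeat an earlier one. -/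
def blockLabel (j : Fin c) : Bool × ℕ × Z × Z :=
  (decide (j.val + 1 = c), l j, P.path z j.castSucc, P.path z j.succ)

theorem injective_blockLabel_prod {y : Fin c → List X} (hy : (List.ofFn y).dropLast.Nodup) :
    Function.Injective fun j => (P.blockLabel z l j, y j) := by
  intro i j hij
  simp only [blockLabel, Prod.mk.injEq, decide_eq_decide] at hij
  obtain ⟨⟨hlast, -⟩, hword⟩ := hij
  by_cases hi : i.val + 1 = c
  · have := hlast.1 hi
    omega
  · have hj := mt hlast.2 hi
    have hlength : (List.ofFn y).dropLast.length = c - 1 := by simp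
    have := (hy.getElem_inj_iff (hi := show i.val < _ by omega) (hj := show j.val < _ by omega)).1
      (by simpa using hword)
    exact Fin.ext this

end Labels

variable [DecidableEq Z]

/-- The transition matrix of the word `w`: its `(z, z')` entry is the probability of emitting `w`
and moving to `z'` when started in `z`. -/
noncomputable def trans (w : List X) : Matrix Z Z ℝ :=
  (w.map fun a => Matrix.of fun z z' => P.prob z a z').prod

/-- The probability of a word given as a list, the counterpart of `wordProb`. -/
noncomputable def listProb (w : List X) : ℝ :=
  ∑ z, P.trans w P.init z

theorem trans_nil : P.trans [] = 1 := rfl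

theorem trans_cons (a : X) (w : List X) :
    P.trans (a :: w) = (Matrix.of fun z z' => P.prob z a z') * P.trans w := by
  simp only [trans, List.map_cons, List.prod_cons]

theorem trans_flatten (L : List (List X)) : P.trans L.flatten = (L.map P.trans).prod := by
  simp only [trans, List.map_flatten, List.prod_flatten, List.map_map]
  rfl

theorem trans_nonneg (w : List X) (z z' : Z) : 0 ≤ P.trans w z z' := by
  induction w generalizing z with
  | nil =>
    rw [trans_nil, Matrix.one_apply]
    positivity
  | cons a w ih =>
    rw [trans_cons, Matrix.mul_apply]
    exact Finset.sum_nonneg fun k _ => mul_nonneg (P.prob_nonneg _ _ _) (ih k)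

theorem listProb_nonneg (w : List X) : 0 ≤ P.listProb w :=
  Finset.sum_nonneg fun _ _ => P.trans_nonneg _ _ _

theorem sum_words_trans (n : ℕ) (z : Z) : ∑ w ∈ words X n, ∑ z', P.trans w z z' = 1 := by
  induction n generalizing z with
  | zero => simp [sum_words, trans_nil, Matrix.one_apply]
  | succ n ih =>
    calc ∑ w ∈ words X (n + 1), ∑ z', P.trans w z z'
        = ∑ a, ∑ w ∈ words X n, ∑ k, P.prob z a k * ∑ z', P.trans w k z' := by
          rw [sum_words_succ]
          refine Finset.sum_congr rfl fun a _ => Finset.sum_congr rfl fun w _ => ?_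
          simp only [trans_cons, Matrix.mul_apply, Matrix.of_apply, Finset.mul_sum]
          exact Finset.sum_comm
      _ = ∑ a, ∑ k, P.prob z a k := by
          refine Finset.sum_congr rfl fun a _ => ?_
          rw [Finset.sum_comm]
          simp only [← Finset.mul_sum, ih, mul_one]
      _ = 1 := P.prob_sum z

theorem sum_words_listProb (n : ℕ) : ∑ w ∈ words X n, P.listProb w = 1 :=
  P.sum_words_trans n P.init

theorem sum_list_prod_apply {c : ℕ} (A : Fin c → Matrix Z Z ℝ) (i : Z) :
    ∑ k, (List.ofFn A).prod i k =
      ∑ z : Fin c → Z, ∏ j, A j ((Fin.cons i z : Fin (c + 1) → Z) j.castSucc) (z j) := by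
  induction c generalizing i with
  | zero => simp [Matrix.one_apply]
  | succ c ih =>
    calc ∑ k, (List.ofFn A).prod i k
        = ∑ k, A 0 i k * ∑ k', (List.ofFn fun j => A (Fin.succ j)).prod k k' := by
          simp only [List.ofFn_succ, List.prod_cons, Matrix.mul_apply, Finset.mul_sum]
          exact Finset.sum_comm
      _ = _ := by
          rw [← (Fin.consEquiv fun _ : Fin (c + 1) => Z).sum_comp, Fintype.sum_prod_type]
          simp only [ih, Finset.mul_sum, Fin.prod_univ_succ]
          rfl

theorem wordProb_eq_listProb {n : ℕ} (x : Fin n → X) : P.wordProb x = P.listProb (List.ofFn x) := by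
  rw [listProb, trans, List.map_ofFn, sum_list_prod_apply]
  rfl

section Blocks

variable {c : ℕ} (z : Fin c → Z) (l : Fin c → ℕ)

/-- The probability of emitting the consecutive blocks `y` while visiting the states `z` at the
block boundaries. -/
noncomputable def pathProb (y : Fin c → List X) : ℝ :=
  ∏ j, P.trans (y j) (P.path z j.castSucc) (P.path z j.succ)

theorem pathProb_nonneg (y : Fin c → List X) : 0 ≤ P.pathProb z y :=
  Finset.prod_nonneg fun _ _ => P.trans_nonneg _ _ _

theorem listProb_flatten (y : Fin c → List X) :
    P.listProb (List.ofFn y).flatten = ∑ z : Fin c → Z, P.pathProb z y := by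
  rw [listProb, trans_flatten, List.map_ofFn, sum_list_prod_apply]
  rfl

theorem sum_blockWords_pathProb_le_one : ∑ y ∈ blockWords X l, P.pathProb z y ≤ 1 := by
  rw [← P.sum_words_listProb (∑ j, l j), ← sum_blockWords_flatten]
  refine Finset.sum_le_sum fun y _ => ?_
  rw [listProb_flatten]
  exact Finset.single_le_sum (fun z _ => P.pathProb_nonneg z y) (Finset.mem_univ z)

variable {z l} {y : Fin c → List X} {π : Equiv.Perm (Fin c)}

theorem pathProb_comp (hπ : π ∈ labelPerms (P.blockLabel z l)) (y : Fin c → List X) :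
    P.pathProb z (y ∘ π) = P.pathProb z y := by
  refine (Finset.prod_congr rfl fun j _ => ?_).trans (Equiv.prod_comp π _)
  have hlabel := congrFun (mem_labelPerms.1 hπ) j
  simp only [blockLabel, Function.comp_apply, Prod.mk.injEq] at hlabel
  rw [Function.comp_apply, hlabel.2.2.1, hlabel.2.2.2]

theorem comp_mem_blockWords (hy : y ∈ blockWords X l) (hπ : π ∈ labelPerms (P.blockLabel z l)) :
    y ∘ π ∈ blockWords X l := by
  refine mem_blockWords.2 fun j => (mem_blockWords.1 hy (π j)).trans ?_
  exact congrArg (fun a => a.2.1) (congrFun (mem_labelPerms.1 hπ) j)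

theorem pathProb_mul_card_labelPerms_le_one (hy : y ∈ blockWords X l)
    (hnodup : (List.ofFn y).dropLast.Nodup) :
    P.pathProb z y * (labelPerms (P.blockLabel z l)).card ≤ 1 := by
  calc P.pathProb z y * (labelPerms (P.blockLabel z l)).card
      = ∑ π ∈ labelPerms (P.blockLabel z l), P.pathProb z (y ∘ π) := by
        rw [Finset.sum_congr rfl fun π hπ => P.pathProb_comp hπ y, Finset.sum_const,
          nsmul_eq_mul, mul_comm]
    _ ≤ ∑ y ∈ blockWords X l, P.pathProb z y :=
        sum_comp_labelPerms_le (P.injective_blockLabel_prod z l hnodup)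
          (fun _ => P.comp_mem_blockWords hy) (P.pathProb_nonneg z)
    _ ≤ 1 := P.sum_blockWords_pathProb_le_one z l

theorem card_labelPerms_blockLabel_le (hy : y ∈ blockWords X l)
    (hnodup : (List.ofFn y).dropLast.Nodup) :
    ((labelPerms (P.blockLabel z l)).card : ℝ) ≤ Fintype.card X ^ ∑ j, l j := by
  calc ((labelPerms (P.blockLabel z l)).card : ℝ)
      = ∑ _π ∈ labelPerms (P.blockLabel z l), 1 := by simp
    _ ≤ ∑ _y ∈ blockWords X l, 1 :=
        sum_comp_labelPerms_le (f := fun _ => 1) (P.injective_blockLabel_prod z l hnodup)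
          (fun _ => P.comp_mem_blockWords hy) fun _ => zero_le_one
    _ = Fintype.card X ^ ∑ j, l j := by
        rw [sum_blockWords_flatten l fun _ => 1]
        simp [card_words]

theorem sum_listProb_flatten_mul_rpow_le {A : Finset (Fin c → List X)} (hA : A ⊆ blockWords X l)
    (hnodup : ∀ y ∈ A, (List.ofFn y).dropLast.Nodup) {g : List X → ℝ} (hg : ∀ w, 0 < g w)
    {M D H ρ : ℝ} (hH : ∑ w ∈ words X (∑ j, l j), 1 / g w ≤ H) (hM : 0 ≤ M) (hD : 0 ≤ D)
    (hMD : ∀ z, M ≤ D * (labelPerms (P.blockLabel z l)).card) (hρ : 0 ≤ ρ) :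
    ∑ y ∈ A, P.listProb (List.ofFn y).flatten * M ^ ρ ≤
      (D * H) ^ ρ * ∑ w ∈ words X (∑ j, l j), P.listProb w * g w ^ ρ := by
  rw [← sum_blockWords_flatten] at hH ⊢
  simp only [listProb_flatten, Finset.sum_mul]
  rw [Finset.sum_comm, Finset.sum_comm (s := blockWords X l), Finset.mul_sum]
  exact Finset.sum_le_sum fun z _ => sum_mul_rpow_le_of_labelPerms hA
    (fun y hy => P.injective_blockLabel_prod z l (hnodup y hy))
    (fun y hy π => P.comp_mem_blockWords hy) (P.pathProb_nonneg z)
    (fun y π hπ => P.pathProb_comp hπ y) (fun y => hg (List.ofFn y).flatten) hH hM hD (hMD z) hρ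

end Blocks

end FiniteStateSource

section BlockBound

variable {s n c : ℕ} {η : ℝ}

/-- A bound for the number of ways to choose the labels of at most `η * n` consecutive blocks of
total length `n`, when there are `s` states. -/
noncomputable def blockBound (s n : ℕ) (η : ℝ) : ℝ :=
  (2 * Real.exp 1 * (s + 1) ^ 3 * ((1 + η) / η)) ^ (η * n) * (1 + η) ^ n

theorem one_le_blockBound_base (s : ℕ) (hη : 0 < η) :
    1 ≤ 2 * Real.exp 1 * (s + 1 : ℝ) ^ 3 * ((1 + η) / η) := by
  have hexp : 1 ≤ 2 * Real.exp 1 := by linarith [Real.add_one_le_exp 1]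
  have hstates : 1 ≤ (s + 1 : ℝ) ^ 3 := one_le_pow₀ (by linarith [Nat.cast_nonneg (α := ℝ) s])
  have hratio : 1 ≤ (1 + η) / η := by
    rw [le_div_iff₀ hη]
    linarith
  exact one_le_mul_of_one_le_of_one_le (one_le_mul_of_one_le_of_one_le hexp hstates) hratio

theorem one_le_blockBound (s n : ℕ) (hη : 0 < η) : 1 ≤ blockBound s n η :=
  one_le_mul_of_one_le_of_one_le
    (Real.one_le_rpow (one_le_blockBound_base s hη) (by positivity)) (one_le_pow₀ (by linarith))

theorem pow_mul_pow_le_blockBound (hη : 0 < η) (hc : (c : ℝ) ≤ η * n) :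
    (s : ℝ) ^ c * ((2 * Real.exp 1 * (s + 1) ^ 2 * ((1 + η) / η)) ^ c * (1 + η) ^ n) ≤
      blockBound s n η := by
  rw [← mul_assoc, ← mul_pow, blockBound]
  gcongr
  calc ((s : ℝ) * (2 * Real.exp 1 * (s + 1) ^ 2 * ((1 + η) / η))) ^ c
      ≤ ((s + 1 : ℝ) * (2 * Real.exp 1 * (s + 1) ^ 2 * ((1 + η) / η))) ^ c := by
        gcongr
        linarith
    _ = (2 * Real.exp 1 * (s + 1) ^ 3 * ((1 + η) / η)) ^ (c : ℝ) := by
        rw [Real.rpow_natCast]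
        ring
    _ ≤ _ := Real.rpow_le_rpow_of_exponent_le (one_le_blockBound_base s hη) hc

theorem card_le_blockBound (s : ℕ) (hη : 0 < η) {T : Finset (List ℕ)}
    (hpos : ∀ L ∈ T, ∀ k ∈ L, 0 < k) (hsum : ∀ L ∈ T, L.sum = n)
    (hlength : ∀ L ∈ T, (L.length : ℝ) ≤ η * n) : (T.card : ℝ) ≤ blockBound s n η := by
  refine (card_le_of_sum_of_length_le hη hpos hsum hlength).trans ?_
  have hfactor : 1 ≤ 2 * Real.exp 1 * (s + 1 : ℝ) ^ 3 :=
    one_le_mul_of_one_le_of_one_le (by linarith [Real.add_one_le_exp 1])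
      (one_le_pow₀ (by linarith [Nat.cast_nonneg (α := ℝ) s]))
  rw [blockBound]
  gcongr
  exact le_mul_of_one_le_left (by positivity) hfactor

end BlockBound

namespace FiniteStateSource

variable {X Z : Type*} [Fintype X] [Fintype Z] (P : FiniteStateSource X Z)

include P in
theorem card_state_pos : 0 < Fintype.card Z := Fintype.card_pos_iff.2 ⟨P.init⟩

variable [DecidableEq Z] {η : ℝ}

theorem pow_self_le_card_labelPerms {c : ℕ} (z : Fin c → Z) (l : Fin c → ℕ) (hη : 0 < η) :
    (c : ℝ) ^ c ≤ (2 * Real.exp 1 * (Fintype.card Z + 1) ^ 2 * ((1 + η) / η)) ^ c *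
      (1 + η) ^ (∑ j, l j) * (labelPerms (P.blockLabel z l)).card := by
  have hq_sum : ∑ a ∈ Finset.univ ×ˢ Finset.range (∑ j, l j + 1) ×ˢ Finset.univ,
      (fun a : Bool × ℕ × Z × Z =>
        lengthWeight η a.2.1 / (2 * (Fintype.card Z + 1) ^ 2)) a ≤ 1 := by
    have hweights := sum_range_lengthWeight hη.le (∑ j, l j + 1)
    simp only [Finset.sum_product, Finset.sum_const, Finset.card_univ, nsmul_eq_mul,
      Fintype.card_bool, Fintype.card_prod, ← Finset.mul_sum, ← Finset.sum_div, hweights]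
    push_cast
    rw [div_le_one (by positivity), ← mul_assoc]
    have : 0 ≤ ((1 + η) ^ (∑ j, l j + 1))⁻¹ := by positivity
    refine (mul_le_of_le_one_right (by positivity) (by linarith)).trans ?_
    nlinarith [Nat.cast_nonneg (α := ℝ) (Fintype.card Z)]
  have hcount := pow_self_mul_prod_le_card_labelPerms (P.blockLabel z l) (fun j => by
      have hj := Finset.single_le_sum (f := l) (fun _ _ => Nat.zero_le _) (Finset.mem_univ j)
      simpa [blockLabel, em] using hj)
    (fun a => div_nonneg (lengthWeight_nonneg hη.le _) (by positivity)) hq_sum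
  have hprod : ∏ j, (fun a : Bool × ℕ × Z × Z =>
      lengthWeight η a.2.1 / (2 * (Fintype.card Z + 1) ^ 2)) (P.blockLabel z l j) =
      ((2 * (Fintype.card Z + 1) ^ 2 * ((1 + η) / η)) ^ c * (1 + η) ^ ∑ j, l j)⁻¹ := by
    simp only [blockLabel, Finset.prod_div_distrib, prod_lengthWeight, Finset.prod_const,
      Finset.card_univ, Fintype.card_fin, mul_inv, div_pow, mul_pow, inv_div]
    field_simp
  rw [hprod, Fintype.card_fin, ← div_eq_mul_inv, div_le_iff₀ (by positivity)] at hcount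
  refine hcount.trans_eq ?_
  simp only [mul_pow]
  ring

theorem card_pow_mul_pow_self_le {c : ℕ} (z : Fin c → Z) (l : Fin c → ℕ) (hη : 0 < η)
    (hc : (c : ℝ) ≤ η * ∑ j, l j) :
    (Fintype.card Z : ℝ) ^ c * (c : ℝ) ^ c ≤
      blockBound (Fintype.card Z) (∑ j, l j) η * (labelPerms (P.blockLabel z l)).card := by
  refine (mul_le_mul_of_nonneg_left (P.pow_self_le_card_labelPerms z l hη) (by positivity)).trans ?_
  rw [← mul_assoc]
  gcongr
  exact pow_mul_pow_le_blockBound hη (mod_cast hc)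

theorem pow_self_le {c : ℕ} (z : Fin c → Z) (l : Fin c → ℕ) (hη : 0 < η)
    (hc : (c : ℝ) ≤ η * ∑ j, l j) :
    (c : ℝ) ^ c ≤
      blockBound (Fintype.card Z) (∑ j, l j) η * (labelPerms (P.blockLabel z l)).card :=
  (le_mul_of_one_le_left (by positivity) (one_le_pow₀ (mod_cast P.card_state_pos))).trans
    (P.card_pow_mul_pow_self_le z l hη hc)

variable [DecidableEq X]

section Ziv

variable {w : List X} {n : ℕ} (hw : w ∈ words X n) (hη : 0 < η)
  (hc : ((lzParse w).length : ℝ) ≤ η * n)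
include hw hη hc

omit [DecidableEq Z] in
include P in
theorem pow_self_length_lzParse_le :
    ((lzParse w).length : ℝ) ^ (lzParse w).length ≤
      blockBound (Fintype.card Z) n η * (Fintype.card X : ℝ) ^ n := by
  classical
  have hsum := (sum_length_get_lzParse w).trans (mem_words.1 hw)
  have hlabels := P.card_labelPerms_blockLabel_le (z := fun _ => P.init)
    (mem_blockWords.2 fun _ => rfl) (nodup_dropLast_ofFn_get_lzParse w)
  refine (P.pow_self_le (fun _ => P.init) (fun j => ((lzParse w).get j).length) hη
    (by rwa [hsum])).trans ?_
  rw [hsum] at hlabels ⊢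
  gcongr
  exact zero_le_one.trans (one_le_blockBound _ _ hη)

theorem listProb_mul_pow_self_le :
    P.listProb w * ((lzParse w).length : ℝ) ^ (lzParse w).length ≤
      blockBound (Fintype.card Z) n η := by
  have hsum := (sum_length_get_lzParse w).trans (mem_words.1 hw)
  have hpath : ∀ z : Fin (lzParse w).length → Z, P.pathProb z (lzParse w).get *
      ((Fintype.card Z : ℝ) ^ (lzParse w).length *
        (lzParse w).length ^ (lzParse w).length) ≤ blockBound (Fintype.card Z) n η := by
    intro z
    have hlabels := P.pathProb_mul_card_labelPerms_le_one (z := z)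
      (mem_blockWords.2 fun _ => rfl) (nodup_dropLast_ofFn_get_lzParse w)
    have hcount := P.card_pow_mul_pow_self_le z (fun j => ((lzParse w).get j).length) hη
      (by rwa [hsum])
    rw [hsum] at hcount
    calc _ ≤ _ := mul_le_mul_of_nonneg_left hcount (P.pathProb_nonneg _ _)
      _ = blockBound (Fintype.card Z) n η * _ := mul_left_comm _ _ _
      _ ≤ _ := mul_le_of_le_one_right (zero_le_one.trans (one_le_blockBound _ _ hη)) hlabels
  have hcard : (0 : ℝ) < Fintype.card Z ^ (lzParse w).length := by
    have := P.card_state_pos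
    positivity
  have htotal := Finset.sum_le_sum fun z (_ : z ∈ Finset.univ) => hpath z
  rw [← Finset.sum_mul, ← listProb_flatten, List.ofFn_get, flatten_lzParse, Finset.sum_const,
    Finset.card_univ, Fintype.card_fun, Fintype.card_fin, nsmul_eq_mul, Nat.cast_pow,
    mul_left_comm] at htotal
  exact le_of_mul_le_mul_left htotal hcard

end Ziv

theorem sum_filter_listProb_mul_rpow_le {L : List ℕ} (hη : 0 < η)
    (hL : (L.length : ℝ) ≤ η * L.sum) {g : List X → ℝ} (hg : ∀ w, 0 < g w) {H ρ : ℝ}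
    (hH : ∑ w ∈ words X L.sum, 1 / g w ≤ H) (hρ : 0 ≤ ρ) :
    ∑ w ∈ words X L.sum with (lzParse w).map List.length = L,
        P.listProb w * ((L.length : ℝ) ^ L.length) ^ ρ ≤
      (blockBound (Fintype.card Z) L.sum η * H) ^ ρ *
        ∑ w ∈ words X L.sum, P.listProb w * g w ^ ρ := by
  have hsum : ∑ j, L.get j = L.sum := by rw [← List.sum_ofFn, List.ofFn_get]
  have hparse : ∀ y ∈ blockWords X L.get, (lzParse (List.ofFn y).flatten).map List.length = L →
      (List.ofFn y).dropLast.Nodup := by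
    intro y hy h
    have hlengths : (List.ofFn y).map List.length = L := by
      rw [List.map_ofFn]
      exact (congrArg List.ofFn (funext (mem_blockWords.1 hy))).trans (List.ofFn_get L)
    rw [← lzParse_flatten_ofFn (h.trans hlengths.symm)]
    exact nodup_dropLast_lzParse _
  have hrearranged := P.sum_listProb_flatten_mul_rpow_le
    (A := {y ∈ blockWords X L.get | (lzParse (List.ofFn y).flatten).map List.length = L})
    (Finset.filter_subset _ _)
    (fun y hy => hparse y (Finset.mem_filter.1 hy).1 (Finset.mem_filter.1 hy).2) hg
    (M := (L.length : ℝ) ^ L.length) (hsum ▸ hH) (by positivity)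
    (zero_le_one.trans (one_le_blockBound _ _ hη))
    (fun z => P.pow_self_le z L.get hη (by rw [hsum]; exact hL)) hρ
  rw [Finset.sum_filter] at hrearranged ⊢
  rwa [sum_blockWords_flatten L.get (f := fun w =>
    if (lzParse w).map List.length = L then P.listProb w * ((L.length : ℝ) ^ L.length) ^ ρ else 0),
    hsum] at hrearranged

end FiniteStateSource

section Rates

/-- An upper bound for the number of phrases per letter, obtained by counting separately the phrases
of length at most `log_β n` and the longer ones, where `β = (α + 2) ^ 2`. -/
noncomputable def phraseRate (α n : ℕ) : ℝ :=
  (1 + √n) / n + 1 / ((Nat.log ((α + 2) ^ 2) n : ℝ) + 1)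

theorem phraseRate_pos (α n : ℕ) : 0 < phraseRate α n := by
  unfold phraseRate
  positivity

theorem pow_natLog_le_sqrt (α : ℕ) {n : ℕ} (hn : n ≠ 0) :
    ((α : ℝ) + 1) ^ Nat.log ((α + 2) ^ 2) n ≤ √n := by
  refine Real.le_sqrt_of_sq_le ?_
  have hlog : (((α : ℝ) + 2) ^ 2) ^ Nat.log ((α + 2) ^ 2) n ≤ n :=
    mod_cast Nat.pow_log_le_self _ hn
  rw [pow_right_comm]
  refine le_trans ?_ hlog
  gcongr
  norm_num

theorem length_lzParse_le_phraseRate_mul {X : Type*} [DecidableEq X] [Fintype X] (w : List X) :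
    ((lzParse w).length : ℝ) ≤ phraseRate (Fintype.card X) w.length * w.length := by
  rcases eq_or_ne w [] with rfl | hw
  · simp [lzParse, lzParseAux]
  · have hlength : w.length ≠ 0 := mt List.length_eq_zero_iff.1 hw
    have hlengthR : (w.length : ℝ) ≠ 0 := mod_cast hlength
    set k := Nat.log ((Fintype.card X + 2) ^ 2) w.length with hk
    have hcount : ((lzParse w).length : ℝ) * (k + 1) ≤
        (1 + (Fintype.card X + 1) ^ k) * (k + 1) + w.length :=
      mod_cast length_lzParse_mul_le w k
    have hk_pos : (0 : ℝ) < k + 1 := by positivity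
    calc ((lzParse w).length : ℝ)
        ≤ ((1 + (Fintype.card X + 1) ^ k) * (k + 1) + w.length) / (k + 1) :=
          (le_div_iff₀ hk_pos).2 hcount
      _ = 1 + (Fintype.card X + 1) ^ k + w.length / (k + 1) := by field_simp
      _ ≤ 1 + √w.length + w.length / (k + 1) := by
          gcongr
          exact pow_natLog_le_sqrt _ hlength
      _ = phraseRate (Fintype.card X) w.length * w.length := by
          rw [phraseRate, ← hk]
          field_simp

theorem tendsto_phraseRate (α : ℕ) :
    Filter.Tendsto (phraseRate α) Filter.atTop (nhds 0) := by
  have hshort : Filter.Tendsto (fun n : ℕ => (1 + √(n : ℝ)) / n) Filter.atTop (nhds 0) := by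
    have hinv : Filter.Tendsto (fun n : ℕ => (n : ℝ)⁻¹ + (√(n : ℝ))⁻¹) Filter.atTop
        (nhds (0 + 0)) :=
      tendsto_inv_atTop_nhds_zero_nat.add (tendsto_inv_atTop_zero.comp
        (Real.tendsto_sqrt_atTop.comp tendsto_natCast_atTop_atTop))
    rw [add_zero] at hinv
    refine hinv.congr fun n => ?_
    rw [add_div, Real.sqrt_div_self, one_div]
  have hlog : Filter.Tendsto (fun n : ℕ => Nat.log ((α + 2) ^ 2) n) Filter.atTop Filter.atTop := by
    refine Filter.tendsto_atTop.2 fun m => ?_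
    filter_upwards [Filter.eventually_ge_atTop (((α + 2) ^ 2) ^ m)] with n hn
    exact Nat.le_log_of_pow_le (Nat.one_lt_pow two_ne_zero (by omega)) hn
  rw [← add_zero (0 : ℝ)]
  exact hshort.add (tendsto_one_div_add_atTop_nhds_zero_nat.comp hlog)

/-- The bound `blockBound` for the parsings of the words of length `n`, times the bound of
`sum_one_div_guess_le` for the harmonic sum of a guessing function. -/
noncomputable def guessingFactor (s α n : ℕ) : ℝ :=
  blockBound s n (phraseRate α n) * (1 + n * α)

theorem one_le_guessingFactor (s α n : ℕ) : 1 ≤ guessingFactor s α n :=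
  one_le_mul_of_one_le_of_one_le (one_le_blockBound s n (phraseRate_pos α n))
    (le_add_of_nonneg_right (by positivity))

theorem blockBound_le_guessingFactor (s α n : ℕ) :
    blockBound s n (phraseRate α n) ≤ guessingFactor s α n :=
  le_mul_of_one_le_right (zero_le_one.trans (one_le_blockBound s n (phraseRate_pos α n)))
    (le_add_of_nonneg_right (by positivity))

/-- The exponential rate of `guessingFactor`. -/
noncomputable def guessingRate (s α n : ℕ) : ℝ :=
  Real.logb 2 (guessingFactor s α n) / n

theorem guessingRate_nonneg (s α n : ℕ) : 0 ≤ guessingRate s α n :=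
  div_nonneg (Real.logb_nonneg one_lt_two (one_le_guessingFactor s α n)) (Nat.cast_nonneg n)

theorem guessingFactor_eq_two_rpow (s α n : ℕ) :
    guessingFactor s α n = 2 ^ (n * guessingRate s α n) := by
  rcases eq_or_ne n 0 with rfl | hn
  · simp [guessingFactor, blockBound]
  · rw [guessingRate, mul_div_cancel₀ _ (Nat.cast_ne_zero.2 hn),
      Real.rpow_logb two_pos (by norm_num)
        (zero_lt_one.trans_le (one_le_guessingFactor s α n))]

theorem tendsto_mul_logb_const_mul_ratio {ι : Type*} {u : Filter ι} {C : ℝ} (hC : 0 < C)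
    {η : ι → ℝ} (hη : ∀ i, 0 < η i) (hη_lim : Filter.Tendsto η u (nhds 0)) :
    Filter.Tendsto (fun i => η i * Real.logb 2 (C * ((1 + η i) / η i)) + Real.logb 2 (1 + η i))
      u (nhds 0) := by
  have hcont : ContinuousAt (fun t : ℝ => (t * Real.log C + t * Real.log (1 + t) -
      t * Real.log t + Real.log (1 + t)) / Real.log 2) 0 := by
    have hlog : ContinuousAt (fun t : ℝ => Real.log (1 + t)) 0 :=
      ContinuousAt.log (by fun_prop) (by norm_num)
    exact ((((continuousAt_id.mul continuousAt_const).add (continuousAt_id.mul hlog)).sub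
      Real.continuous_mul_log.continuousAt).add hlog).div_const _
  have hlim := hcont.tendsto.comp hη_lim
  simp only [zero_mul, add_zero, Real.log_one, sub_zero, zero_div] at hlim
  refine hlim.congr fun i => ?_
  have := hη i
  simp only [Function.comp_apply, Real.logb]
  rw [Real.log_mul hC.ne' (by positivity), Real.log_div (by positivity) this.ne']
  ring

theorem tendsto_logb_one_add_mul_div {a : ℝ} (ha : 0 ≤ a) :
    Filter.Tendsto (fun n : ℕ => Real.logb 2 (1 + n * a) / n) Filter.atTop (nhds 0) := by
  rcases ha.eq_or_lt with rfl | ha_pos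
  · simp
  · have harg : Filter.Tendsto (fun n : ℕ => 1 + n * a) Filter.atTop Filter.atTop :=
      Filter.tendsto_atTop_add_const_left _ _ (tendsto_natCast_atTop_atTop.atTop_mul_const ha_pos)
    refine ((Real.tendsto_pow_logb_div_mul_add_atTop (b := 2) a⁻¹ (-a⁻¹) 1
      (inv_ne_zero ha_pos.ne')).comp harg).congr fun n => ?_
    have hn : a⁻¹ * (1 + n * a) + -a⁻¹ = n := by
      field_simp
      ring
    rw [Function.comp_apply, pow_one, hn]

theorem tendsto_guessingRate (s α : ℕ) :
    Filter.Tendsto (guessingRate s α) Filter.atTop (nhds 0) := by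
  have hlim := (tendsto_mul_logb_const_mul_ratio (C := 2 * Real.exp 1 * (s + 1) ^ 3)
    (by positivity) (phraseRate_pos α) (tendsto_phraseRate α)).add
    (tendsto_logb_one_add_mul_div (Nat.cast_nonneg α))
  rw [add_zero] at hlim
  refine hlim.congr' ?_
  filter_upwards [Filter.eventually_ne_atTop 0] with n hn
  have hη := phraseRate_pos α n
  have hn' : (n : ℝ) ≠ 0 := Nat.cast_ne_zero.2 hn
  have hbase := zero_lt_one.trans_le (one_le_blockBound_base s hη)
  have hblock : 0 < blockBound s n (phraseRate α n) :=
    zero_lt_one.trans_le (one_le_blockBound s n hη)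
  rw [guessingRate, guessingFactor, Real.logb_mul hblock.ne' (by positivity), blockBound,
    Real.logb_mul (Real.rpow_pos_of_pos hbase _).ne' (by positivity),
    Real.logb_rpow_eq_mul_logb_of_pos hbase, Real.logb_pow]
  field_simp

/-- The loss `Δₙ(s, α)` in the converse bound for guessing. The factor `√v` of the second summand,
where `v` is the `guessingRate`, comes from the threshold between the two ranges of `ρ`. -/
noncomputable def guessingLoss (s α n : ℕ) : ℝ :=
  guessingRate s α n +
    √(guessingRate s α n) * (1 + guessingRate s α n + Real.logb 2 α)

theorem tendsto_guessingLoss (s α : ℕ) :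
    Filter.Tendsto (guessingLoss s α) Filter.atTop (nhds 0) := by
  have hrate := tendsto_guessingRate s α
  have hloss := hrate.add
    (hrate.sqrt.mul ((hrate.const_add 1).add_const (Real.logb 2 (α : ℝ))))
  rwa [Real.sqrt_zero, zero_mul, add_zero] at hloss

variable {s α n : ℕ} {ρ : ℝ}

theorem guessingFactor_mul_rpow_le (hα : 0 < α) (hρ : √(guessingRate s α n) ≤ ρ) :
    guessingFactor s α n * guessingFactor s α n ^ ρ ≤ 2 ^ (ρ * n * guessingLoss s α n) := by
  have ha : 0 ≤ Real.logb 2 α := Real.logb_nonneg one_lt_two (mod_cast hα)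
  have hv := guessingRate_nonneg s α n
  rw [guessingFactor_eq_two_rpow, ← Real.rpow_mul two_pos.le, ← Real.rpow_add two_pos, guessingLoss]
  set v := guessingRate s α n
  set a := Real.logb 2 α
  have hρ₀ : 0 ≤ ρ := (Real.sqrt_nonneg v).trans hρ
  refine Real.rpow_le_rpow_of_exponent_le one_le_two ?_
  calc n * v + n * v * ρ = n * (√v * √v + v * ρ) := by
        rw [Real.mul_self_sqrt hv]
        ring
    _ ≤ n * (ρ * √v + v * ρ + ρ * (√v * (v + a))) := by
        have hrest : 0 ≤ ρ * (√v * (v + a)) := by positivity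
        have hsqrt : √v * √v ≤ ρ * √v := by gcongr
        refine mul_le_mul_of_nonneg_left ?_ (Nat.cast_nonneg n)
        linarith
    _ = ρ * n * (v + √v * (1 + v + a)) := by ring

theorem guessingFactor_mul_rpow_rpow_le (hα : 0 < α) (hρ₀ : 0 ≤ ρ)
    (hρ : ρ ≤ √(guessingRate s α n)) :
    (guessingFactor s α n * (guessingFactor s α n * (α : ℝ) ^ n) ^ ρ) ^ ρ ≤
      2 ^ (ρ * n * guessingLoss s α n) := by
  have ha : 0 ≤ Real.logb 2 α := Real.logb_nonneg one_lt_two (mod_cast hα)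
  have hv := guessingRate_nonneg s α n
  have hpow : (α : ℝ) ^ n = 2 ^ (n * Real.logb 2 α) := by
    rw [mul_comm, Real.rpow_mul two_pos.le, Real.rpow_logb two_pos (by norm_num) (mod_cast hα),
      Real.rpow_natCast]
  rw [guessingFactor_eq_two_rpow, hpow, ← Real.rpow_add two_pos, ← Real.rpow_mul two_pos.le,
    ← Real.rpow_add two_pos, ← Real.rpow_mul two_pos.le, guessingLoss]
  set v := guessingRate s α n
  set a := Real.logb 2 α
  refine Real.rpow_le_rpow_of_exponent_le one_le_two ?_
  calc (n * v + (n * v + n * a) * ρ) * ρ = ρ * n * (v + ρ * (v + a)) := by ring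
    _ ≤ ρ * n * (v + √v * (1 + v + a)) := by
        gcongr
        linarith

end Rates

theorem sum_one_div_guess_le {X : Type*} [Fintype X] {n : ℕ} {G : (Fin n → X) → ℕ}
    (hG : IsGuessingFunction G) : ∑ x, 1 / (G x : ℝ) ≤ 1 + n * Fintype.card X := by
  classical
  have himage : Finset.univ.image G = Finset.Icc 1 (Fintype.card X ^ n) := by
    rw [← Finset.coe_inj]
    simpa using hG.image_eq
  calc ∑ x, 1 / (G x : ℝ) = ∑ k ∈ Finset.Icc 1 (Fintype.card X ^ n), 1 / (k : ℝ) := by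
        rw [← himage, Finset.sum_image fun x _ y _ h => hG.injOn trivial trivial h]
    _ = (harmonic (Fintype.card X ^ n) : ℚ) := by simp [harmonic_eq_sum_Icc]
    _ ≤ 1 + Real.log (Fintype.card X ^ n : ℕ) := harmonic_le_one_add_log _
    _ = 1 + n * Real.log (Fintype.card X) := by rw [Nat.cast_pow, Real.log_pow]
    _ ≤ 1 + n * Fintype.card X := by
        gcongr
        exact Real.log_le_self (Nat.cast_nonneg _)

theorem two_rpow_mul_logb_self (c : ℕ) (ρ : ℝ) :
    (2 : ℝ) ^ (ρ * ((c : ℝ) * Real.logb 2 c)) = ((c : ℝ) ^ c) ^ ρ := by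
  rcases Nat.eq_zero_or_pos c with rfl | hc
  · simp
  · rw [mul_comm ρ, Real.rpow_mul two_pos.le, mul_comm (c : ℝ), Real.rpow_mul two_pos.le,
      Real.rpow_logb two_pos (by norm_num) (mod_cast hc), Real.rpow_natCast]

namespace FiniteStateSource

variable {X Z : Type*} [Fintype X] [Fintype Z] (P : FiniteStateSource X Z)

include P in
theorem card_alphabet_pos : 0 < Fintype.card X := by
  rw [Fintype.card_pos_iff]
  by_contra h
  rw [not_nonempty_iff] at h
  simpa using P.prob_sum P.init

variable [DecidableEq Z] {n : ℕ} {η H ρ : ℝ} {g : List X → ℝ}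

theorem sum_listProb_mul_rpow_nonneg (hg : ∀ w, 0 < g w) :
    0 ≤ ∑ w ∈ words X n, P.listProb w * g w ^ ρ :=
  Finset.sum_nonneg fun w _ => mul_nonneg (P.listProb_nonneg w) (Real.rpow_nonneg (hg w).le ρ)

variable [DecidableEq X]

theorem sum_listProb_mul_rpow_le_of_rearrangement (hη : 0 < η)
    (hc : ∀ w ∈ words X n, ((lzParse w).length : ℝ) ≤ η * n) (hg : ∀ w, 0 < g w)
    (hH : ∑ w ∈ words X n, 1 / g w ≤ H) (hρ : 0 ≤ ρ) :
    ∑ w ∈ words X n, P.listProb w * (((lzParse w).length : ℝ) ^ (lzParse w).length) ^ ρ ≤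
      blockBound (Fintype.card Z) n η * (blockBound (Fintype.card Z) n η * H) ^ ρ *
        ∑ w ∈ words X n, P.listProb w * g w ^ ρ := by
  set lengths : List X → List ℕ := fun w => (lzParse w).map List.length with hlengths
  set D := blockBound (Fintype.card Z) n η
  set R := ∑ w ∈ words X n, P.listProb w * g w ^ ρ
  have hsum : ∀ w ∈ words X n, (lengths w).sum = n := fun w hw =>
    (sum_map_length_lzParse w).trans (mem_words.1 hw)
  have hlength : ∀ w ∈ words X n, ((lengths w).length : ℝ) ≤ η * n := fun w hw => by
    simpa only [hlengths, List.length_map] using hc w hw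
  have hcard : (((words X n).image lengths).card : ℝ) ≤ D := by
    refine card_le_blockBound _ hη (Finset.forall_mem_image.2 fun w _ k hk => ?_)
      (Finset.forall_mem_image.2 hsum) (Finset.forall_mem_image.2 hlength)
    obtain ⟨p, hp, rfl⟩ := List.mem_map.1 hk
    exact length_pos_of_mem_lzParse hp
  have hfibre : ∀ L ∈ (words X n).image lengths,
      ∑ w ∈ words X n with lengths w = L,
        P.listProb w * (((lzParse w).length : ℝ) ^ (lzParse w).length) ^ ρ ≤ (D * H) ^ ρ * R := by
    refine Finset.forall_mem_image.2 fun u hu => ?_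
    have hbound := P.sum_filter_listProb_mul_rpow_le (L := lengths u) (H := H) hη
      (by simpa only [hsum u hu] using hlength u hu) hg (by rwa [hsum u hu]) hρ
    rw [hsum u hu] at hbound
    calc _ = ∑ w ∈ words X n with lengths w = lengths u,
            P.listProb w * (((lengths u).length : ℝ) ^ (lengths u).length) ^ ρ :=
          Finset.sum_congr rfl fun w hw => by
            rw [← (Finset.mem_filter.1 hw).2, hlengths, List.length_map]
      _ ≤ (D * H) ^ ρ * R := hbound
  have hDHR : 0 ≤ (D * H) ^ ρ * R := by
    have hD_nonneg : 0 ≤ D := zero_le_one.trans (one_le_blockBound _ n hη)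
    have hH_nonneg : 0 ≤ H := (Finset.sum_nonneg fun w _ => (one_div_pos.2 (hg w)).le).trans hH
    exact mul_nonneg (by positivity) (P.sum_listProb_mul_rpow_nonneg hg)
  calc _ = ∑ L ∈ (words X n).image lengths, ∑ w ∈ words X n with lengths w = L,
          P.listProb w * (((lzParse w).length : ℝ) ^ (lzParse w).length) ^ ρ :=
        (Finset.sum_fiberwise_of_maps_to (fun w hw => Finset.mem_image_of_mem _ hw) _).symm
    _ ≤ ((words X n).image lengths).card • ((D * H) ^ ρ * R) :=
        Finset.sum_le_card_nsmul _ _ _ hfibre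
    _ ≤ D * ((D * H) ^ ρ * R) := by
        rw [nsmul_eq_mul]
        gcongr
    _ = D * (D * H) ^ ρ * R := (mul_assoc _ _ _).symm

theorem sum_listProb_mul_rpow_le_of_ziv (hη : 0 < η)
    (hc : ∀ w ∈ words X n, ((lzParse w).length : ℝ) ≤ η * n) (hg : ∀ w, 0 < g w)
    (hH : ∑ w ∈ words X n, 1 / g w ≤ H) (hρ : 0 ≤ ρ) :
    ∑ w ∈ words X n, P.listProb w * (((lzParse w).length : ℝ) ^ (lzParse w).length) ^ ρ ≤
      (blockBound (Fintype.card Z) n η * H *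
          (blockBound (Fintype.card Z) n η * (Fintype.card X : ℝ) ^ n) ^ ρ) ^ ρ *
        ∑ w ∈ words X n, P.listProb w * g w ^ ρ := by
  have hD := zero_le_one.trans (one_le_blockBound (Fintype.card Z) n hη)
  have hH_nonneg : 0 ≤ ∑ w ∈ words X n, 1 / g w :=
    Finset.sum_nonneg fun w _ => (one_div_pos.2 (hg w)).le
  have htilted := sum_mul_rpow_le_of_mul_le (words X n) P.listProb_nonneg
    (M := fun w => ((lzParse w).length : ℝ) ^ (lzParse w).length)
    (P.sum_words_listProb n) (fun w => mod_cast Nat.pow_self_pos)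
    (fun w hw => P.pow_self_length_lzParse_le hw hη (hc w hw))
    (fun w hw => P.listProb_mul_pow_self_le hw hη (hc w hw)) hg hρ
  refine htilted.trans ?_
  have := P.sum_listProb_mul_rpow_nonneg (n := n) (ρ := ρ) hg
  rw [mul_right_comm]
  gcongr

theorem sum_listProb_mul_rpow_le (hg : ∀ w, 0 < g w)
    (hH : ∑ w ∈ words X n, 1 / g w ≤ 1 + n * Fintype.card X) (hρ : 0 ≤ ρ) :
    ∑ w ∈ words X n, P.listProb w * (((lzParse w).length : ℝ) ^ (lzParse w).length) ^ ρ ≤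
      2 ^ (ρ * n * guessingLoss (Fintype.card Z) (Fintype.card X) n) *
        ∑ w ∈ words X n, P.listProb w * g w ^ ρ := by
  have hη := phraseRate_pos (Fintype.card X) n
  have hc : ∀ w ∈ words X n, ((lzParse w).length : ℝ) ≤ phraseRate (Fintype.card X) n * n :=
    fun w hw => mem_words.1 hw ▸ length_lzParse_le_phraseRate_mul w
  have hR := P.sum_listProb_mul_rpow_nonneg (n := n) (ρ := ρ) hg
  have hF := zero_le_one.trans (one_le_guessingFactor (Fintype.card Z) (Fintype.card X) n)
  have hD := blockBound_le_guessingFactor (Fintype.card Z) (Fintype.card X) n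
  rcases le_total √(guessingRate (Fintype.card Z) (Fintype.card X) n) ρ with hlarge | hsmall
  · refine (P.sum_listProb_mul_rpow_le_of_rearrangement hη hc hg hH hρ).trans ?_
    gcongr
    refine le_trans ?_ (guessingFactor_mul_rpow_le P.card_alphabet_pos hlarge)
    rw [← guessingFactor]
    gcongr
  · refine (P.sum_listProb_mul_rpow_le_of_ziv hη hc hg hH hρ).trans ?_
    gcongr
    refine le_trans ?_ (guessingFactor_mul_rpow_rpow_le P.card_alphabet_pos hρ hsmall)
    rw [← guessingFactor]
    have := zero_le_one.trans (one_le_blockBound (Fintype.card Z) n hη)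
    gcongr

end FiniteStateSource

theorem theorem2_general :
    ∃ Δ : ℕ → ℕ → ℕ → ℝ,
      (∀ s α : ℕ, Filter.Tendsto (fun n => Δ s α n) Filter.atTop (nhds 0)) ∧
      ∀ (X Z : Type*) [Fintype X] [DecidableEq X] [Fintype Z]
        (P : FiniteStateSource X Z) (n : ℕ) (g : (Fin n → X) → ℝ),
        (∀ x, 0 < g x) → ∑ x, 1 / g x ≤ 1 + n * Fintype.card X →
        ∀ ρ : ℝ, 0 ≤ ρ →
          P.expect (fun x => g x ^ ρ) ≥
            (2 : ℝ) ^ (-(ρ * n * Δ (Fintype.card Z) (Fintype.card X) n)) *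
              P.expect (fun x : Fin n → X =>
                (2 : ℝ) ^ (ρ * ((lzCount x : ℝ) * Real.logb 2 (lzCount x : ℝ)))) := by
  refine ⟨guessingLoss, tendsto_guessingLoss, ?_⟩
  intro X Z _ _ _ P n g hg hsum ρ hρ
  classical
  have hext : ∀ x, Function.extend List.ofFn g 1 (List.ofFn x) = g x :=
    List.ofFn_injective.extend_apply _ _
  have hpos : ∀ w, 0 < Function.extend List.ofFn g 1 w := by
    intro w
    by_cases hw : ∃ x : Fin n → X, List.ofFn x = w
    · obtain ⟨x, rfl⟩ := hw
      exact (hext x).symm ▸ hg x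
    · rw [Function.extend_apply' _ _ _ hw]
      exact one_pos
  have hbound := P.sum_listProb_mul_rpow_le (n := n) hpos
    (by simpa only [sum_words, hext] using hsum) hρ
  simp only [sum_words, hext, ← P.wordProb_eq_listProb] at hbound
  simp only [FiniteStateSource.expect, two_rpow_mul_logb_self, lzCount]
  rwa [ge_iff_le, Real.rpow_neg two_pos.le, inv_mul_le_iff₀ (by positivity)]

theorem theorem2 :
    ∃ Δ : ℕ → ℕ → ℕ → ℝ,
      (∀ s α : ℕ, Filter.Tendsto (fun n => Δ s α n) Filter.atTop (nhds 0)) ∧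
      ∀ (X Z : Type*) [Fintype X] [DecidableEq X] [Fintype Z]
        (P : FiniteStateSource X Z) (n : ℕ) (G : (Fin n → X) → ℕ),
        IsGuessingFunction G →
        ∀ ρ : ℝ, 0 < ρ →
          P.expect (fun x => (G x : ℝ) ^ ρ) ≥
            (2 : ℝ) ^ (-(ρ * n * Δ (Fintype.card Z) (Fintype.card X) n)) *
              P.expect (fun x : Fin n → X =>
                (2 : ℝ) ^ (ρ * ((lzCount x : ℝ) * Real.logb 2 (lzCount x : ℝ)))) := by
  obtain ⟨Δ, hΔ, hbound⟩ := theorem2_general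
  exact ⟨Δ, hΔ, fun X Z _ _ _ P n G hG ρ hρ => hbound X Z P n (fun x => (G x : ℝ))
    (fun x => mod_cast (hG.mapsTo (Set.mem_univ x)).1) (sum_one_div_guess_le hG) ρ hρ.le⟩
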